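/- Let $J_k$ ($k\in\mathbb N=\{0,1,2,\dots\}$) be the Bessel function of the first kind of order $k$, let $0<j_{k,1}<j_{k,2}<\cdots$ be its positive zeros in increasing order, and let $k\in\mathbb N$, $\kappa>0$. For $\alpha>0$ put $$F_k(\alpha)=\frac{\kappa}{\alpha}J_k(\alpha)J_k'\Bigl(\frac{\kappa}{\alpha}\Bigr)-\alpha J_k\Bigl(\frac{\kappa}{\alpha}\Bigr)J_k'(\alpha),$$ let $\alpha_{k,1}=\alpha_{k,1}(\kappa)$ be the smallest root of $F_k$ in $(\sqrt\kappa,+\infty)$, and let $\alpha_{k,-1}=\kappa/\alpha_{k,1}$. A radial profile $R_{k,1}$ is a function $$R_{k,1}(r)=c\,J_k(\alpha_{k,1}r)+d\,J_k(\alpha_{k,-1}r),$$ where $(c,d)\in\mathbb R^2\setminus\{(0,0)\}$ solves $$c\,J_k(\alpha_{k,1})+d\,J_k(\alpha_{k,-1})=0,\qquad c\,\alpha_{k,1}J_k'(\alpha_{k,1})+d\,\alpha_{k,-1}J_k'(\alpha_{k,-1})=0 .$$ **Proposition.** Let $k,n\in\mathbb N$ with $n\ge2$, and let $\kappa>0$.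 Then $$\kappa\in(j_{k,n-1}j_{k,n},\,j_{k,n}j_{k,n+1})\quad\Longleftrightarrow\quad\alpha_{k,1}(\kappa)\in(j_{k,n},\,j_{k,n+1}).$$ If these equivalent conditions hold, then a non-trivial solution $(c,d)$ of the above system exists, and every radial profile $R_{k,1}$ has exactly $n-1$ zeros in $(0,1)$, all of which are simple. -/

import Mathlib

open Set

noncomputable section

namespace Buckling

/-- The Bessel function of the first kind `J_k` of integer order `k ≥ 0`, on the real line, by its
everywhere convergent power series. -/
def besselJ (k : ℕ) (x : ℝ) : ℝ :=
  ∑' m : ℕ, (-1 : ℝ) ^ m / ((m.factorial : ℝ) * ((m + k).factorial : ℝ)) * (x / 2) ^ (2 * m + k)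

/-- The derivative `J_k'`. -/
def besselJ' (k : ℕ) (x : ℝ) : ℝ := deriv (besselJ k) x

/-- `rootAfter f a n` is the `n`-th root of `f` in the open half-line `(a, ∞)`, counted
in increasing order from `n = 1`, with the convention `rootAfter f a 0 = a`. -/
def rootAfter (f : ℝ → ℝ) (a : ℝ) : ℕ → ℝ
  | 0 => a
  | n + 1 => sInf {x : ℝ | rootAfter f a n < x ∧ f x = 0}

/-- The `n`-th positive root `j_{k,n}` of `J_k` (`n ≥ 1`), with the convention `j_{k,0} = 0`. -/
def besselZero (k n : ℕ) : ℝ := rootAfter (besselJ k) 0 n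

/-- `F_k(α) = (κ/α) J_k(α) J_k'(κ/α) - α J_k(κ/α) J_k'(α)`, considered for `α > 0`. -/
def F (k : ℕ) (κ α : ℝ) : ℝ :=
  κ / α * besselJ k α * besselJ' k (κ / α) - α * besselJ k (κ / α) * besselJ' k α

/-- The root `α_{k,ℓ}(κ)`, `ℓ ∈ ℤ`, of `F_k`: `α_{k,0} = √κ`, for `ℓ ≥ 1` it is the `ℓ`-th root
above `√κ`, and `α_{k,-ℓ} = κ / α_{k,ℓ}`. -/
def alphaRoot (k : ℕ) (κ : ℝ) : ℤ → ℝ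
  | Int.ofNat l => rootAfter (F k κ) (Real.sqrt κ) l
  | Int.negSucc l => κ / rootAfter (F k κ) (Real.sqrt κ) (l + 1)

/-- `R` is a radial profile `R_{k,ℓ}`: it is `r ↦ c J_k(α_{k,ℓ} r) + d J_k(α_{k,-ℓ} r)` for a
non-trivial solution `(c, d)` of the linear system expressing the clamped boundary conditions
`R(1) = R'(1) = 0`. -/
def IsRadialProfile (k : ℕ) (κ : ℝ) (l : ℤ) (R : ℝ → ℝ) : Prop :=
  ∃ c d : ℝ, (c, d) ≠ (0, 0) ∧
    c * besselJ k (alphaRoot k κ l) + d * besselJ k (κ / alphaRoot k κ l) = 0 ∧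
    c * alphaRoot k κ l * besselJ' k (alphaRoot k κ l) +
      d * (κ / alphaRoot k κ l) * besselJ' k (κ / alphaRoot k κ l) = 0 ∧
    ∀ r : ℝ, R r = c * besselJ k (alphaRoot k κ l * r) + d * besselJ k (alphaRoot k κ (-l) * r)

end Buckling

end

/-!
Write Bessel's equation as a first-order system for `(J_k, x J_k')` and pass to polar coordinates,
`J_k = ρ sin φ`, `x J_k' = ρ cos φ` on `(0, ∞)` (`IsPhase`, `exists_isPhase`). The phase satisfies
`x φ' = (x² - k²) sin² φ + cos² φ`. It is strictly increasing, because the right-hand side is a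
positive multiple of the energy `(x J_k')² + (x² - k²) J_k² = 2 ∫₀ˣ s J_k(s)² ds`; it is unbounded,
because `x φ' ≥ 1` for large `x`; and it takes values in `(0, π)` near `0`. Hence `j_{k,n}` is the
solution of `φ = n π` (`IsPhase.besselZero_succ_spec`).

Up to a positive factor, `F_k(α)` is `sin (φ(α) - φ(κ/α))`. The difference `φ(α) - φ(κ/α)` is
strictly increasing and vanishes at `√κ`, so `α_{k,1}` is the point at which it equals `π`
(`IsPhase.alphaRoot_one_spec`). Evaluating it at `j_{k,n}` and `j_{k,n+1}` gives the equivalence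
(`IsPhase.mem_Ioo_iff_alphaRoot_mem`).

For the zeros put `α = α_{k,1}`, `β = κ/α`. The phase difference `D(r) = φ(α r) - φ(β r)` is
positive, equals `π` at `r = 1`, and stays below `π` on `(0, 1)` because it can cross the level `π`
only upwards (`IsPhase.exists_pi_le_sub`, `IsPhase.sub_lt_pi`). Therefore the Wronskian of
`J_k(α r)` and `J_k(β r)`, a negative multiple of `sin D`, has no zero in `(0, 1)`. This makes the
zeros of a profile simple, and by Rolle's theorem separates any two zeros of it in `(0, 1]`,
including the one at `r = 1`, by a zero of `J_k(β r)`. As `β` lies between `j_{k,n-1}` and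
`j_{k,n}`, there are at most `n - 1` zeros in `(0, 1)`. On the other hand the coefficients `c`, `d`
have the same sign, and the profile changes sign between consecutive zeros of `J_k(β r)`, and
between `0` and the first one, which gives `n - 1` zeros (`IsPhase.exists_profile_zero`,
`IsPhase.ncard_profile_zeros`).
-/

open Set

noncomputable section

namespace Buckling

/-! ### The power series and the Bessel equation -/

/-- The entire function `g_k(y) = ∑ (-1)^m y^m / (m! (m+k)!)`, for which
`J_k(x) = (x/2)^k g_k((x/2)^2)`. -/
def besselSeries (k : ℕ) (y : ℝ) : ℝ :=
  ∑' m : ℕ, (-1 : ℝ) ^ m / ((m.factorial : ℝ) * ((m + k).factorial : ℝ)) * y ^ m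

lemma abs_besselCoeff_le (k m : ℕ) :
    |(-1 : ℝ) ^ m / ((m.factorial : ℝ) * ((m + k).factorial : ℝ))| ≤ 1 / (m.factorial : ℝ) := by
  rw [abs_div, abs_pow, abs_neg, abs_one, one_pow, abs_of_pos (by positivity)]
  have h1 : (1 : ℝ) ≤ ((m + k).factorial : ℝ) := by exact_mod_cast Nat.factorial_pos _
  have h2 : (0 : ℝ) < (m.factorial : ℝ) := by positivity
  exact one_div_le_one_div_of_le h2 (le_mul_of_one_le_right h2.le h1)

lemma summable_besselSeries (k : ℕ) (y : ℝ) :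
    Summable fun m : ℕ =>
      (-1 : ℝ) ^ m / ((m.factorial : ℝ) * ((m + k).factorial : ℝ)) * y ^ m := by
  refine Summable.of_norm_bounded (Real.summable_pow_div_factorial |y|) fun m => ?_
  rw [Real.norm_eq_abs, abs_mul, abs_pow, div_eq_mul_one_div (|y| ^ m), mul_comm (|y| ^ m)]
  exact mul_le_mul_of_nonneg_right (abs_besselCoeff_le k m) (by positivity)

lemma hasDerivAt_besselSeries (k : ℕ) (y : ℝ) :
    HasDerivAt (besselSeries k) (-besselSeries (k + 1) y) y := by
  set r : ℝ := |y| + 1 with hr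
  have hr0 : 0 < r := by positivity
  have hu : Summable fun m : ℕ => 1 / (m.factorial : ℝ) * (m * r ^ (m - 1)) := by
    rw [← summable_nat_add_iff 1]
    refine (Real.summable_pow_div_factorial r).congr fun m => ?_
    have : (m.factorial : ℝ) ≠ 0 := by positivity
    rw [Nat.factorial_succ]
    push_cast
    field_simp
  have hy : y ∈ Metric.ball (0 : ℝ) r := by
    rw [Metric.mem_ball, dist_zero_right, Real.norm_eq_abs]; linarith
  have h := hasDerivAt_tsum_of_isPreconnected hu (t := Metric.ball (0 : ℝ) r)
    (g := fun m x => (-1 : ℝ) ^ m / ((m.factorial : ℝ) * ((m + k).factorial : ℝ)) * x ^ m)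
    (g' := fun m x =>
      (-1 : ℝ) ^ m / ((m.factorial : ℝ) * ((m + k).factorial : ℝ)) * (m * x ^ (m - 1)))
    Metric.isOpen_ball (convex_ball _ _).isPreconnected
    (fun m x _ => (hasDerivAt_pow m x).const_mul _)
    (fun m x hx => ?_) hy (summable_besselSeries k y) hy
  · refine h.congr_deriv ?_
    have hs : Summable fun m : ℕ =>
        (-1 : ℝ) ^ m / ((m.factorial : ℝ) * ((m + k).factorial : ℝ)) * (m * y ^ (m - 1)) := by
      refine Summable.of_norm_bounded hu fun m => ?_
      rw [Real.norm_eq_abs, abs_mul, abs_mul, abs_pow, Nat.abs_cast]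
      gcongr
      · exact abs_besselCoeff_le k m
      · linarith
    rw [hs.tsum_eq_zero_add, besselSeries, ← tsum_neg]
    simp only [Nat.cast_zero, zero_mul, mul_zero, zero_add]
    refine tsum_congr fun m => ?_
    have h1 : (m.factorial : ℝ) ≠ 0 := by positivity
    have h2 : ((m + 1 + k).factorial : ℝ) ≠ 0 := by positivity
    rw [show m + (k + 1) = m + 1 + k by ring, Nat.factorial_succ m, pow_succ]
    push_cast
    field_simp
  · rw [Metric.mem_ball, dist_zero_right, Real.norm_eq_abs] at hx
    rw [Real.norm_eq_abs, abs_mul, abs_mul, abs_pow, Nat.abs_cast]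
    gcongr
    exact abs_besselCoeff_le k m

lemma besselSeries_recurrence (k : ℕ) (y : ℝ) :
    y * besselSeries (k + 2) y = (k + 1) * besselSeries (k + 1) y - besselSeries k y := by
  rw [besselSeries, besselSeries, besselSeries, (summable_besselSeries (k + 1) y).tsum_eq_zero_add,
    (summable_besselSeries k y).tsum_eq_zero_add, mul_add, add_sub_add_comm, ← tsum_mul_left,
    ← tsum_mul_left, ← Summable.tsum_sub]
  · have h0 : (k.factorial : ℝ) ≠ 0 := by positivity
    have h1 : ((k : ℝ) + 1) * ((-1 : ℝ) ^ 0 / (((0 : ℕ).factorial : ℝ) *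
        ((0 + (k + 1)).factorial : ℝ)) * y ^ 0) - (-1 : ℝ) ^ 0 / (((0 : ℕ).factorial : ℝ) *
        ((0 + k).factorial : ℝ)) * y ^ 0 = 0 := by
      rw [zero_add, zero_add, Nat.factorial_succ]
      push_cast
      field_simp
      simp
    rw [h1, zero_add]
    refine tsum_congr fun m => ?_
    have h2 : (m.factorial : ℝ) ≠ 0 := by positivity
    have h3 : ((m + 1 + k).factorial : ℝ) ≠ 0 := by positivity
    rw [show m + (k + 2) = (m + 1 + k) + 1 by ring, show m + 1 + (k + 1) = (m + 1 + k) + 1 by ring,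
      Nat.factorial_succ (m + 1 + k), Nat.factorial_succ m]
    push_cast
    field_simp
    ring
  · exact (((summable_nat_add_iff 1).2 (summable_besselSeries (k + 1) y)).mul_left _)
  · exact (summable_nat_add_iff 1).2 (summable_besselSeries k y)

lemma besselSeries_zero_pos (k : ℕ) : 0 < besselSeries k 0 := by
  rw [besselSeries, tsum_eq_single 0 fun m hm => by rw [zero_pow hm, mul_zero]]
  simp only [pow_zero, mul_one]
  positivity

lemma besselJ_eq (k : ℕ) (x : ℝ) :
    besselJ k x = (x / 2) ^ k * besselSeries k ((x / 2) ^ 2) := by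
  rw [besselJ, besselSeries, ← tsum_mul_left]
  refine tsum_congr fun m => ?_
  rw [pow_add, pow_mul]
  ring

/-- The numerator `x J_k'(x)` of the logarithmic derivative of `J_k` with respect to `log x`. -/
def besselK (k : ℕ) (x : ℝ) : ℝ := x * besselJ' k x

lemma hasDerivAt_besselSeries_comp (k : ℕ) (x : ℝ) :
    HasDerivAt (fun x : ℝ => besselSeries k ((x / 2) ^ 2))
      (-(x / 2) * besselSeries (k + 1) ((x / 2) ^ 2)) x := by
  have h : HasDerivAt (fun x : ℝ => (x / 2) ^ 2) (x / 2) x := by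
    refine (((hasDerivAt_id x).div_const 2).pow 2).congr_deriv ?_
    simp; ring
  refine ((hasDerivAt_besselSeries k ((x / 2) ^ 2)).comp x h).congr_deriv ?_
  ring

lemma hasDerivAt_half_pow (k : ℕ) (x : ℝ) :
    HasDerivAt (fun x : ℝ => (x / 2) ^ k) (k * (x / 2) ^ (k - 1) / 2) x := by
  refine (((hasDerivAt_id x).div_const 2).pow k).congr_deriv ?_
  simp; ring

lemma differentiable_besselJ (k : ℕ) : Differentiable ℝ (besselJ k) := fun x => by
  have := ((hasDerivAt_half_pow k x).mul (hasDerivAt_besselSeries_comp k x)).differentiableAt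
  exact this.congr_of_eventuallyEq (Filter.Eventually.of_forall (besselJ_eq k))

lemma hasDerivAt_besselJ (k : ℕ) (x : ℝ) : HasDerivAt (besselJ k) (besselJ' k x) x :=
  (differentiable_besselJ k x).hasDerivAt

lemma besselK_eq (k : ℕ) (x : ℝ) :
    besselK k x = k * besselJ k x - 2 * ((x / 2) ^ (k + 2) * besselSeries (k + 1) ((x / 2) ^ 2)) := by
  have h := (((hasDerivAt_half_pow k x).mul (hasDerivAt_besselSeries_comp k x)).congr_of_eventuallyEq
    (Filter.Eventually.of_forall (besselJ_eq k))).unique (hasDerivAt_besselJ k x)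
  rw [besselK, ← h, besselJ_eq]
  rcases k with _ | k
  · simp; ring
  · simp only [Nat.add_sub_cancel]; push_cast; ring

/-- Bessel's equation, written as a first-order system for `J_k` and `x J_k'`. -/
lemma hasDerivAt_besselK (k : ℕ) {x : ℝ} (hx : x ≠ 0) :
    HasDerivAt (besselK k) ((k ^ 2 - x ^ 2) * besselJ k x / x) x := by
  have h := (((hasDerivAt_besselJ k x).const_mul (k : ℝ)).sub
    (((hasDerivAt_half_pow (k + 2) x).mul (hasDerivAt_besselSeries_comp (k + 1) x)).const_mul
      2)).congr_of_eventuallyEq (f₁ := besselK k) (Filter.Eventually.of_forall (besselK_eq k))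
  refine h.congr_deriv ?_
  have h1 : besselJ' k x * x = k * besselJ k x
      - 2 * ((x / 2) ^ (k + 2) * besselSeries (k + 1) ((x / 2) ^ 2)) := by
    rw [← besselK_eq, besselK, mul_comm]
  have h2 := besselSeries_recurrence k ((x / 2) ^ 2)
  rw [eq_div_iff hx]
  simp only [show k + 2 - 1 = k + 1 by omega, show k + 1 + 1 = k + 2 by ring]
  push_cast
  have h3 := besselJ_eq k x
  linear_combination (k : ℝ) * h1 + 4 * (x / 2) ^ (k + 2) * h2 + x ^ 2 * h3

lemma continuous_besselK (k : ℕ) : Continuous (besselK k) := by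
  have h : Continuous fun x : ℝ => besselSeries (k + 1) ((x / 2) ^ 2) :=
    continuous_iff_continuousAt.2 fun x => (hasDerivAt_besselSeries_comp (k + 1) x).continuousAt
  have h' := (differentiable_besselJ k).continuous
  rw [show besselK k = _ from funext (besselK_eq k)]
  fun_prop

lemma exists_besselJ_pos (k : ℕ) : ∃ δ > 0, ∀ x ∈ Ioo (0 : ℝ) δ, 0 < besselJ k x := by
  have h := (hasDerivAt_besselSeries_comp k 0).continuousAt
  have h0 : 0 < besselSeries k (((0 : ℝ) / 2) ^ 2) := by simpa using besselSeries_zero_pos k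
  obtain ⟨δ, hδ, hb⟩ := Metric.eventually_nhds_iff.1 (h.eventually (lt_mem_nhds h0))
  refine ⟨δ, hδ, fun x hx => ?_⟩
  rw [besselJ_eq]
  have hx0 := hx.1
  refine mul_pos (by positivity) (hb ?_)
  rw [Real.dist_eq, sub_zero, abs_of_pos hx.1]
  exact hx.2

/-! ### Positivity of the energy -/

/-- The energy `(x J_k')^2 + (x^2 - k^2) J_k^2`, equal to `2 ∫₀ˣ s J_k(s)^2 ds`. -/
def besselEnergy (k : ℕ) (x : ℝ) : ℝ :=
  besselK k x ^ 2 + (x ^ 2 - k ^ 2) * besselJ k x ^ 2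

lemma hasDerivAt_besselEnergy (k : ℕ) {x : ℝ} (hx : x ≠ 0) :
    HasDerivAt (besselEnergy k) (2 * x * besselJ k x ^ 2) x := by
  refine (((hasDerivAt_besselK k hx).pow 2).add ((((hasDerivAt_id x).pow 2).sub_const
    ((k : ℝ) ^ 2)).mul ((hasDerivAt_besselJ k x).pow 2))).congr_deriv ?_
  have : besselK k x = x * besselJ' k x := rfl
  simp only [this, id, Pi.pow_apply]
  field_simp
  push_cast
  ring

lemma besselEnergy_zero (k : ℕ) : besselEnergy k 0 = 0 := by
  rcases k with _ | k
  · simp [besselEnergy, besselK]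
  · simp [besselEnergy, besselK, besselJ_eq]

lemma continuous_besselEnergy (k : ℕ) : Continuous (besselEnergy k) := by
  have h := continuous_besselK k
  have h' := (differentiable_besselJ k).continuous
  unfold besselEnergy
  fun_prop

lemma besselEnergy_pos (k : ℕ) {x : ℝ} (hx : 0 < x) : 0 < besselEnergy k x := by
  obtain ⟨δ, hδ, hJ⟩ := exists_besselJ_pos k
  have hmono : MonotoneOn (besselEnergy k) (Ici 0) := by
    refine monotoneOn_of_deriv_nonneg (convex_Ici 0) (continuous_besselEnergy k).continuousOn ?_ ?_
    · intro y hy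
      rw [interior_Ici] at hy
      exact (hasDerivAt_besselEnergy k (ne_of_gt hy)).differentiableAt.differentiableWithinAt
    · intro y hy
      rw [interior_Ici, mem_Ioi] at hy
      rw [(hasDerivAt_besselEnergy k (ne_of_gt hy)).deriv]
      positivity
  have hstrict : StrictMonoOn (besselEnergy k) (Icc 0 δ) := by
    refine strictMonoOn_of_deriv_pos (convex_Icc 0 δ) (continuous_besselEnergy k).continuousOn ?_
    intro y hy
    rw [interior_Icc] at hy
    rw [(hasDerivAt_besselEnergy k (ne_of_gt hy.1)).deriv]
    have := hJ y hy
    have := hy.1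
    positivity
  have hm : 0 < min x δ := lt_min hx hδ
  calc 0 = besselEnergy k 0 := (besselEnergy_zero k).symm
    _ < besselEnergy k (min x δ) := hstrict ⟨le_rfl, hδ.le⟩ ⟨hm.le, min_le_right _ _⟩ hm
    _ ≤ besselEnergy k x := hmono hm.le hx.le (min_le_left _ _)

/-! ### The phase function -/

/-- `φ` and `ρ` are a phase and a modulus of `J_k` on `(0, ∞)`: the polar coordinates of the point
`(x J_k', J_k)`, with `φ` normalised to take values in `(0, π)` near `0`. -/
structure IsPhase (k : ℕ) (φ ρ : ℝ → ℝ) : Prop where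
  modulus_pos : ∀ x, 0 < x → 0 < ρ x
  besselJ_eq : ∀ x, 0 < x → besselJ k x = ρ x * Real.sin (φ x)
  besselK_eq : ∀ x, 0 < x → besselK k x = ρ x * Real.cos (φ x)
  hasDerivAt : ∀ x, 0 < x →
    HasDerivAt φ (((x ^ 2 - k ^ 2) * Real.sin (φ x) ^ 2 + Real.cos (φ x) ^ 2) / x) x
  phase_pos : ∀ x, 0 < x → 0 < φ x
  exists_phase_lt_pi : ∃ x, 0 < x ∧ φ x < Real.pi

/-- The function `√(J_k^2 + (x J_k')^2)`. -/
def besselModulus (k : ℕ) (x : ℝ) : ℝ := √(besselJ k x ^ 2 + besselK k x ^ 2)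

lemma besselModulus_pos (k : ℕ) {x : ℝ} (hx : 0 < x) : 0 < besselModulus k x := by
  refine Real.sqrt_pos.2 ?_
  by_contra h
  have hJ : besselJ k x = 0 := by nlinarith [sq_nonneg (besselJ k x), sq_nonneg (besselK k x)]
  have hK : besselK k x = 0 := by nlinarith [sq_nonneg (besselJ k x), sq_nonneg (besselK k x)]
  have := besselEnergy_pos k hx
  simp [besselEnergy, hJ, hK] at this

lemma besselModulus_sq (k : ℕ) (x : ℝ) :
    besselModulus k x ^ 2 = besselJ k x ^ 2 + besselK k x ^ 2 := Real.sq_sqrt (by positivity)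

/-- The angular velocity of the point `(x J_k', J_k)`. -/
def besselPhaseRate (k : ℕ) (x : ℝ) : ℝ := besselEnergy k x / (x * besselModulus k x ^ 2)

lemma hasDerivAt_besselModulus (k : ℕ) {x : ℝ} (hx : 0 < x) :
    HasDerivAt (besselModulus k)
      ((1 + k ^ 2 - x ^ 2) * besselJ k x * besselK k x / (x * besselModulus k x)) x := by
  have hm := besselModulus_pos k hx
  have h0 : besselJ k x ^ 2 + besselK k x ^ 2 ≠ 0 := by rw [← besselModulus_sq]; positivity
  refine ((((hasDerivAt_besselJ k x).pow 2).add
    ((hasDerivAt_besselK k hx.ne').pow 2)).sqrt h0).congr_deriv ?_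
  have h1 : besselK k x = x * besselJ' k x := rfl
  have h2 : √((besselJ k ^ 2 + besselK k ^ 2) x) = besselModulus k x := rfl
  rw [h2, h1]
  field_simp
  push_cast
  ring

/-- The unit vector in the direction of `(x J_k', J_k)` rotates with velocity `besselPhaseRate`. -/
lemma hasDerivAt_besselJ_div_modulus (k : ℕ) {x : ℝ} (hx : 0 < x) :
    HasDerivAt (fun x => besselJ k x / besselModulus k x)
      (besselK k x / besselModulus k x * besselPhaseRate k x) x := by
  have hm := besselModulus_pos k hx
  refine ((hasDerivAt_besselJ k x).div (hasDerivAt_besselModulus k hx) hm.ne').congr_deriv ?_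
  have h1 : besselJ' k x = besselK k x / x := by rw [besselK]; field_simp
  have h2 := besselModulus_sq k x
  rw [h1, besselPhaseRate, besselEnergy]
  field_simp
  rw [h2]
  ring

lemma hasDerivAt_besselK_div_modulus (k : ℕ) {x : ℝ} (hx : 0 < x) :
    HasDerivAt (fun x => besselK k x / besselModulus k x)
      (-(besselJ k x / besselModulus k x * besselPhaseRate k x)) x := by
  have hm := besselModulus_pos k hx
  refine ((hasDerivAt_besselK k hx.ne').div (hasDerivAt_besselModulus k hx) hm.ne').congr_deriv ?_
  have h2 := besselModulus_sq k x
  rw [besselPhaseRate, besselEnergy]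
  field_simp
  rw [h2]
  ring

lemma continuousOn_besselPhaseRate (k : ℕ) : ContinuousOn (besselPhaseRate k) (Ioi 0) := by
  refine (continuous_besselEnergy k).continuousOn.div (continuousOn_id.mul
    (ContinuousOn.pow (fun x hx =>
      (hasDerivAt_besselModulus k hx).continuousAt.continuousWithinAt) 2)) fun x hx => ?_
  have hx' : 0 < x := hx
  have := besselModulus_pos k hx'
  positivity

lemma exists_isPhase (k : ℕ) : ∃ φ ρ : ℝ → ℝ, IsPhase k φ ρ := by
  obtain ⟨δ, hδ, hJpos⟩ := exists_besselJ_pos k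
  set a : ℝ := δ / 2 with ha
  have ha0 : 0 < a := by positivity
  have hJa : 0 < besselJ k a := hJpos a ⟨ha0, by rw [ha]; linarith⟩
  set z : ℂ := ⟨besselK k a, besselJ k a⟩ with hz
  have hz0 : z ≠ 0 := fun h => hJa.ne' (congrArg Complex.im h)
  have hza : ‖z‖ = besselModulus k a := by
    rw [Complex.norm_eq_sqrt_sq_add_sq, besselModulus, add_comm]
  set φ : ℝ → ℝ := fun x => z.arg + ∫ t in a..x, besselPhaseRate k t with hφ
  have hφa : φ a = z.arg := by simp [hφ]
  have hd : ∀ x, 0 < x → HasDerivAt φ (besselPhaseRate k x) x := fun x hx => by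
    refine HasDerivAt.const_add _ ?_
    refine intervalIntegral.integral_hasDerivAt_right ?_ ?_ ?_
    · refine ContinuousOn.intervalIntegrable ((continuousOn_besselPhaseRate k).mono fun t ht => ?_)
      exact lt_of_lt_of_le (lt_min ha0 hx) ht.1
    · exact (continuousOn_besselPhaseRate k).stronglyMeasurableAtFilter isOpen_Ioi x hx
    · exact (continuousOn_besselPhaseRate k).continuousAt (isOpen_Ioi.mem_nhds hx)
  have hconst : ∀ f : ℝ → ℝ, (∀ x, 0 < x → HasDerivAt f 0 x) → ∀ x, 0 < x → f x = f a := by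
    intro f hf x hx
    refine isOpen_Ioi.is_const_of_deriv_eq_zero (s := Ioi (0 : ℝ)) isPreconnected_Ioi
      (fun y hy => (hf y hy).differentiableAt.differentiableWithinAt)
      (fun y hy => (hf y hy).deriv) hx ha0
  have hsin : Real.sin z.arg = besselJ k a / besselModulus k a := by rw [Complex.sin_arg, hza]
  have hcos : Real.cos z.arg = besselK k a / besselModulus k a := by
    rw [Complex.cos_arg hz0, hza]
  -- In the frame rotating with angle `φ` the unit vector has constant coordinates.
  have hA : ∀ x, 0 < x → besselJ k x / besselModulus k x * Real.cos (φ x)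
      - besselK k x / besselModulus k x * Real.sin (φ x) = 0 := by
    intro x hx
    rw [hconst (fun x => besselJ k x / besselModulus k x * Real.cos (φ x)
      - besselK k x / besselModulus k x * Real.sin (φ x)) (fun y hy => ?_) x hx, hφa, hsin, hcos]
    · ring
    · refine (((hasDerivAt_besselJ_div_modulus k hy).mul (hd y hy).cos).sub
        ((hasDerivAt_besselK_div_modulus k hy).mul (hd y hy).sin)).congr_deriv ?_
      ring
  have hB : ∀ x, 0 < x → besselJ k x / besselModulus k x * Real.sin (φ x)
      + besselK k x / besselModulus k x * Real.cos (φ x) = 1 := by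
    intro x hx
    rw [hconst (fun x => besselJ k x / besselModulus k x * Real.sin (φ x)
      + besselK k x / besselModulus k x * Real.cos (φ x)) (fun y hy => ?_) x hx, hφa, ← hsin,
      ← hcos]
    · linear_combination Real.sin_sq_add_cos_sq z.arg
    · refine (((hasDerivAt_besselJ_div_modulus k hy).mul (hd y hy).sin).add
        ((hasDerivAt_besselK_div_modulus k hy).mul (hd y hy).cos)).congr_deriv ?_
      ring
  have hJ : ∀ x, 0 < x → besselJ k x = besselModulus k x * Real.sin (φ x) := fun x hx => by
    have hm := besselModulus_pos k hx
    rw [mul_comm, ← div_eq_iff hm.ne']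
    linear_combination Real.cos (φ x) * hA x hx + Real.sin (φ x) * hB x hx
      - besselJ k x / besselModulus k x * Real.sin_sq_add_cos_sq (φ x)
  have hK : ∀ x, 0 < x → besselK k x = besselModulus k x * Real.cos (φ x) := fun x hx => by
    have hm := besselModulus_pos k hx
    rw [mul_comm, ← div_eq_iff hm.ne']
    linear_combination -Real.sin (φ x) * hA x hx + Real.cos (φ x) * hB x hx
      - besselK k x / besselModulus k x * Real.sin_sq_add_cos_sq (φ x)
  have hmono : StrictMonoOn φ (Ioi 0) := by
    refine strictMonoOn_of_deriv_pos (convex_Ioi 0)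
      (fun x hx => (hd x hx).continuousAt.continuousWithinAt) fun x hx => ?_
    rw [interior_Ioi] at hx
    have hx' : 0 < x := hx
    have := besselModulus_pos k hx'
    have := besselEnergy_pos k hx'
    rw [(hd x hx').deriv, besselPhaseRate]
    positivity
  have harg : 0 < z.arg := by
    refine lt_of_le_of_ne (Complex.arg_nonneg_iff.2 hJa.le) fun h => ?_
    rw [← h, Real.sin_zero] at hsin
    have := besselModulus_pos k ha0
    have : 0 < besselJ k a / besselModulus k a := by positivity
    linarith
  refine ⟨φ, besselModulus k, fun x => besselModulus_pos k, hJ, hK, fun x hx => ?_, ?_,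
    a, ha0, ?_⟩
  · refine (hd x hx).congr_deriv ?_
    have hm := besselModulus_pos k hx
    rw [besselPhaseRate, besselEnergy, hJ x hx, hK x hx]
    field_simp
    ring
  · intro x hx
    rcases lt_or_ge a x with h | h
    · exact (hφa ▸ harg).trans (hmono ha0 hx h)
    -- On `(0, a]` the function `J_k` has no zero, so `φ` cannot reach the value `0`.
    by_contra hneg
    obtain ⟨y, hy, hy0⟩ := intermediate_value_Icc h
      (fun t ht => (hd t (hx.trans_le ht.1)).continuousAt.continuousWithinAt)
      (show (0 : ℝ) ∈ Icc (φ x) (φ a) from ⟨not_lt.1 hneg, (hφa ▸ harg).le⟩)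
    have hy' : 0 < y := hx.trans_le hy.1
    have := hJpos y ⟨hy', by linarith [hy.2]⟩
    rw [hJ y hy', hy0] at this
    simp at this
  · rw [hφa]
    refine lt_of_le_of_ne (Complex.arg_le_pi z) fun h => ?_
    rw [h, Real.sin_pi] at hsin
    have := besselModulus_pos k ha0
    have : 0 < besselJ k a / besselModulus k a := by positivity
    linarith

/-! ### Zeros of `J_k` and roots of `F_k` in terms of the phase -/

/-- The derivative of the phase is the energy divided by `x ρ^2`. -/
lemma IsPhase.rate_pos {k : ℕ} {φ ρ : ℝ → ℝ} (h : IsPhase k φ ρ) {x : ℝ} (hx : 0 < x) :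
    0 < ((x ^ 2 - k ^ 2) * Real.sin (φ x) ^ 2 + Real.cos (φ x) ^ 2) / x := by
  have hE := besselEnergy_pos k hx
  have hρ := h.modulus_pos x hx
  rw [besselEnergy, h.besselJ_eq x hx, h.besselK_eq x hx,
    show (ρ x * Real.cos (φ x)) ^ 2 + (x ^ 2 - k ^ 2) * (ρ x * Real.sin (φ x)) ^ 2
      = ρ x ^ 2 * ((x ^ 2 - k ^ 2) * Real.sin (φ x) ^ 2 + Real.cos (φ x) ^ 2) by ring] at hE
  exact div_pos (pos_of_mul_pos_right hE (by positivity)) hx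

lemma IsPhase.continuousOn {k : ℕ} {φ ρ : ℝ → ℝ} (h : IsPhase k φ ρ) :
    ContinuousOn φ (Ioi 0) :=
  fun x hx => (h.hasDerivAt x hx).continuousAt.continuousWithinAt

lemma IsPhase.strictMonoOn {k : ℕ} {φ ρ : ℝ → ℝ} (h : IsPhase k φ ρ) :
    StrictMonoOn φ (Ioi 0) := by
  refine strictMonoOn_of_deriv_pos (convex_Ioi 0) h.continuousOn fun x hx => ?_
  rw [interior_Ioi] at hx
  rw [(h.hasDerivAt x hx).deriv]
  exact h.rate_pos hx

/-- The phase grows at least like `log x`, since `x φ' ≥ 1` as soon as `x^2 ≥ k^2 + 1`. In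
particular `J_k` has infinitely many zeros. -/
lemma IsPhase.unbounded {k : ℕ} {φ ρ : ℝ → ℝ} (h : IsPhase k φ ρ) (C : ℝ) :
    ∃ X, 0 < X ∧ ∀ x, X ≤ x → C ≤ φ x := by
  set a : ℝ := k + 1 with ha
  have ha0 : 0 < a := by positivity
  have hmono : MonotoneOn (fun x => φ x - Real.log x) (Ici a) := by
    have hd : ∀ x ∈ Ici a, HasDerivAt (fun x => φ x - Real.log x)
        (((x ^ 2 - k ^ 2) * Real.sin (φ x) ^ 2 + Real.cos (φ x) ^ 2) / x - x⁻¹) x := fun x hx =>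
      (h.hasDerivAt x (ha0.trans_le hx)).sub (Real.hasDerivAt_log (ha0.trans_le hx).ne')
    refine monotoneOn_of_deriv_nonneg (convex_Ici a)
      (fun x hx => (hd x hx).continuousAt.continuousWithinAt)
      (fun x hx => (hd x (interior_subset hx)).differentiableAt.differentiableWithinAt)
      fun x hx => ?_
    have hx' : a ≤ x := interior_subset hx
    have hx0 : 0 < x := ha0.trans_le hx'
    rw [(hd x hx').deriv, ← one_div, ← sub_div, Real.cos_sq']
    refine div_nonneg ?_ hx0.le
    have h1 : 0 ≤ x ^ 2 - k ^ 2 - 1 := by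
      have : (0 : ℝ) ≤ k := by positivity
      nlinarith
    nlinarith [mul_nonneg h1 (sq_nonneg (Real.sin (φ x)))]
  refine ⟨max a (Real.exp (C - (φ a - Real.log a))), lt_max_of_lt_left ha0, fun x hx => ?_⟩
  have hax : a ≤ x := (le_max_left _ _).trans hx
  have h1 := hmono (mem_Ici.2 le_rfl) hax hax
  have h2 := (Real.le_log_iff_exp_le (ha0.trans_le hax)).2 ((le_max_right _ _).trans hx)
  simp only at h1
  linarith

lemma IsPhase.exists_eq {k : ℕ} {φ ρ : ℝ → ℝ} (h : IsPhase k φ ρ) {C : ℝ} (hC : Real.pi ≤ C) :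
    ∃ x, 0 < x ∧ φ x = C := by
  obtain ⟨a, ha0, ha⟩ := h.exists_phase_lt_pi
  obtain ⟨X, -, hX⟩ := h.unbounded C
  obtain ⟨x, hx, hxC⟩ := intermediate_value_Icc (le_max_left a X)
    (h.continuousOn.mono fun t ht => ha0.trans_le ht.1)
    (show C ∈ Icc (φ a) (φ (max a X)) from ⟨(ha.trans_le hC).le, hX _ (le_max_right _ _)⟩)
  exact ⟨x, ha0.trans_le hx.1, hxC⟩

lemma IsPhase.besselJ_eq_zero_iff {k : ℕ} {φ ρ : ℝ → ℝ} (h : IsPhase k φ ρ) {x : ℝ}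
    (hx : 0 < x) : besselJ k x = 0 ↔ ∃ m : ℤ, (m : ℝ) * Real.pi = φ x := by
  rw [h.besselJ_eq x hx, mul_eq_zero_iff_left (h.modulus_pos x hx).ne', Real.sin_eq_zero_iff]

lemma rootAfter_succ_eq {f : ℝ → ℝ} {a x : ℝ} {n : ℕ} (hx : rootAfter f a n < x) (hfx : f x = 0)
    (hmin : ∀ y, rootAfter f a n < y → f y = 0 → x ≤ y) : rootAfter f a (n + 1) = x :=
  IsLeast.csInf_eq (s := {x : ℝ | rootAfter f a n < x ∧ f x = 0})
    ⟨⟨hx, hfx⟩, fun y hy => hmin y hy.1 hy.2⟩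

lemma IsPhase.besselZero_succ_spec_of_lt_iff {k : ℕ} {φ ρ : ℝ → ℝ} (h : IsPhase k φ ρ) {n : ℕ}
    (h0 : 0 ≤ besselZero k n)
    (hlt : ∀ y, 0 < y → (besselZero k n < y ↔ n * Real.pi < φ y)) :
    0 < besselZero k (n + 1) ∧ φ (besselZero k (n + 1)) = (n + 1) * Real.pi := by
  have hpi := Real.pi_pos
  obtain ⟨x, hx0, hx⟩ := h.exists_eq (C := (n + 1) * Real.pi)
    (le_mul_of_one_le_left hpi.le (by linarith [(Nat.cast_nonneg n : (0 : ℝ) ≤ n)]))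
  have he : besselZero k (n + 1) = x := by
    refine rootAfter_succ_eq ((hlt x hx0).2 (by rw [hx]; linarith))
      ((h.besselJ_eq_zero_iff hx0).2 ⟨n + 1, by rw [hx]; push_cast; ring⟩) fun y hy hJ => ?_
    have hy0 : 0 < y := h0.trans_lt hy
    obtain ⟨j, hj⟩ := (h.besselJ_eq_zero_iff hy0).1 hJ
    have h1 := (hlt y hy0).1 hy
    rw [← hj] at h1
    have h2 : (n : ℤ) + 1 ≤ j := by exact_mod_cast lt_of_mul_lt_mul_right h1 hpi.le
    have h3 : (n : ℝ) + 1 ≤ j := by exact_mod_cast h2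
    rw [← h.strictMonoOn.le_iff_le hx0 hy0, hx, ← hj]
    exact mul_le_mul_of_nonneg_right h3 hpi.le
  rw [he]
  exact ⟨hx0, hx⟩

lemma IsPhase.besselZero_lt_iff {k : ℕ} {φ ρ : ℝ → ℝ} (h : IsPhase k φ ρ) (n : ℕ) :
    0 ≤ besselZero k n ∧ ∀ y, 0 < y → (besselZero k n < y ↔ n * Real.pi < φ y) := by
  induction n with
  | zero =>
    refine ⟨le_rfl, fun y hy => ?_⟩
    simp only [besselZero, rootAfter, Nat.cast_zero, zero_mul, hy, true_iff]
    exact h.phase_pos y hy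
  | succ m ih =>
    obtain ⟨h0, he⟩ := h.besselZero_succ_spec_of_lt_iff ih.1 ih.2
    refine ⟨h0.le, fun y hy => ?_⟩
    rw [← h.strictMonoOn.lt_iff_lt h0 hy, he]
    push_cast
    rfl

/-- The positive zeros of `J_k` are the points where the phase is a multiple of `π`. -/
lemma IsPhase.besselZero_succ_spec {k : ℕ} {φ ρ : ℝ → ℝ} (h : IsPhase k φ ρ) (n : ℕ) :
    0 < besselZero k (n + 1) ∧ φ (besselZero k (n + 1)) = (n + 1) * Real.pi :=
  h.besselZero_succ_spec_of_lt_iff (h.besselZero_lt_iff n).1 (h.besselZero_lt_iff n).2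

lemma F_eq (k : ℕ) (κ α : ℝ) :
    F k κ α = besselJ k α * besselK k (κ / α) - besselJ k (κ / α) * besselK k α := by
  simp only [F, besselK]
  ring

lemma IsPhase.F_eq_zero_iff {k : ℕ} {φ ρ : ℝ → ℝ} (h : IsPhase k φ ρ) {κ α : ℝ} (hκ : 0 < κ)
    (hα : 0 < α) : F k κ α = 0 ↔ ∃ m : ℤ, (m : ℝ) * Real.pi = φ α - φ (κ / α) := by
  have hβ : 0 < κ / α := div_pos hκ hα
  have hF : F k κ α = ρ α * ρ (κ / α) * Real.sin (φ α - φ (κ / α)) := by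
    rw [Real.sin_sub, F_eq, h.besselJ_eq α hα, h.besselJ_eq _ hβ, h.besselK_eq α hα,
      h.besselK_eq _ hβ]
    ring
  rw [hF, mul_eq_zero_iff_left (mul_pos (h.modulus_pos α hα) (h.modulus_pos _ hβ)).ne',
    Real.sin_eq_zero_iff]

lemma IsPhase.strictMonoOn_sub {k : ℕ} {φ ρ : ℝ → ℝ} (h : IsPhase k φ ρ) {κ : ℝ} (hκ : 0 < κ) :
    StrictMonoOn (fun α => φ α - φ (κ / α)) (Ioi 0) := fun _ hx _ hy hxy =>
  sub_lt_sub (h.strictMonoOn hx hy hxy)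
    (h.strictMonoOn (div_pos hκ hy) (div_pos hκ hx) (div_lt_div_of_pos_left hκ hx hxy))

/-- The root `α_{k,1}` is the point at which the phase difference `φ(α) - φ(κ/α)`, which
increases strictly from `0` at `√κ`, reaches `π`. -/
lemma IsPhase.alphaRoot_one_spec {k : ℕ} {φ ρ : ℝ → ℝ} (h : IsPhase k φ ρ) {κ : ℝ} (hκ : 0 < κ) :
    √κ < alphaRoot k κ 1 ∧
      φ (alphaRoot k κ 1) - φ (κ / alphaRoot k κ 1) = Real.pi := by
  have hpi := Real.pi_pos
  have hs : 0 < √κ := Real.sqrt_pos.2 hκ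
  have hm := h.strictMonoOn_sub hκ
  have hs0 : φ (√κ) - φ (κ / √κ) = 0 := by rw [Real.div_sqrt, sub_self]
  obtain ⟨X, -, hX⟩ := h.unbounded (φ (√κ) + Real.pi)
  have hY : √κ ≤ max X (√κ) := le_max_right _ _
  have hY0 : 0 < max X (√κ) := hs.trans_le hY
  have hYpi : Real.pi ≤ φ (max X (√κ)) - φ (κ / max X (√κ)) := by
    have h1 := hX _ (le_max_left X (√κ))
    have h2 : φ (κ / max X (√κ)) ≤ φ (√κ) := by
      refine h.strictMonoOn.monotoneOn (div_pos hκ hY0) hs ?_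
      rw [div_le_iff₀ hY0]
      nlinarith [Real.mul_self_sqrt hκ.le]
    linarith
  obtain ⟨a, ha, hapi⟩ := intermediate_value_Icc hY (f := fun α => φ α - φ (κ / α))
    (fun t ht => by
      have ht0 : 0 < t := hs.trans_le ht.1
      exact ((h.hasDerivAt t ht0).continuousAt.sub
        ((h.hasDerivAt _ (div_pos hκ ht0)).continuousAt.comp (f := fun t => κ / t)
          (continuousAt_const.div continuousAt_id ht0.ne'))).continuousWithinAt)
    (show Real.pi ∈ Icc (φ (√κ) - φ (κ / √κ)) _ from ⟨by rw [hs0]; exact hpi.le, hYpi⟩)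
  have ha0 : 0 < a := hs.trans_le ha.1
  simp only at hapi
  have hsa : √κ < a := by
    rw [← hm.lt_iff_lt hs ha0]
    simp only [hs0, hapi, hpi]
  have he : alphaRoot k κ 1 = a := by
    refine rootAfter_succ_eq (n := 0) hsa
      ((h.F_eq_zero_iff hκ ha0).2 ⟨1, by rw [hapi]; push_cast; ring⟩) fun y hy hF => ?_
    have hy' : √κ < y := hy
    have hy0 : 0 < y := hs.trans hy'
    obtain ⟨j, hj⟩ := (h.F_eq_zero_iff hκ hy0).1 hF
    have h1 := hm hs hy0 hy'
    simp only [hs0, ← hj] at h1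
    have h2 : (1 : ℤ) ≤ j := by
      have : (0 : ℝ) < j := pos_of_mul_pos_left h1 hpi.le
      exact_mod_cast this
    have h3 : (1 : ℝ) ≤ j := by exact_mod_cast h2
    rw [← hm.le_iff_le ha0 hy0]
    simp only [hapi, ← hj]
    exact le_mul_of_one_le_left hpi.le h3
  rw [he]
  exact ⟨hsa, hapi⟩

lemma IsPhase.mem_Ioo_iff_alphaRoot_mem {k : ℕ} {φ ρ : ℝ → ℝ} (h : IsPhase k φ ρ) {κ : ℝ}
    (hκ : 0 < κ) (m : ℕ) :
    κ ∈ Ioo (besselZero k m * besselZero k (m + 1)) (besselZero k (m + 1) * besselZero k (m + 2)) ↔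
      alphaRoot k κ 1 ∈ Ioo (besselZero k (m + 1)) (besselZero k (m + 2)) := by
  obtain ⟨hsα, hα⟩ := h.alphaRoot_one_spec hκ
  have hα0 : 0 < alphaRoot k κ 1 := (Real.sqrt_nonneg κ).trans_lt hsα
  have hm := h.strictMonoOn_sub hκ
  obtain ⟨hp0, hp⟩ := h.besselZero_succ_spec m
  obtain ⟨hq0, hq⟩ := h.besselZero_succ_spec (m + 1)
  push_cast at hq
  refine and_congr ?_ ?_
  · rw [← lt_div_iff₀ hp0, (h.besselZero_lt_iff m).2 _ (div_pos hκ hp0), ← hm.lt_iff_lt hp0 hα0]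
    simp only [hα, hp]
    constructor <;> intro _ <;> linarith
  · rw [← div_lt_iff₀ hq0, ← h.strictMonoOn.lt_iff_lt (div_pos hκ hq0) hp0,
      ← hm.lt_iff_lt hα0 hq0]
    simp only [hα, hq, hp]
    constructor <;> intro _ <;> linarith

/-! ### The phase difference along a ray -/

lemma sin_mul_sin_pos {x y : ℝ} (m : ℤ) (hx : x ∈ Ioo (m * Real.pi) ((m + 1) * Real.pi))
    (hy : y ∈ Ioo (m * Real.pi) ((m + 1) * Real.pi)) : 0 < Real.sin x * Real.sin y := by
  have h1 := Real.sin_pos_of_pos_of_lt_pi (x := x - m * Real.pi) (by linarith [hx.1])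
    (by linarith [hx.2])
  have h2 := Real.sin_pos_of_pos_of_lt_pi (x := y - m * Real.pi) (by linarith [hy.1])
    (by linarith [hy.2])
  have h3 := mul_pos h1 h2
  rw [Real.sin_sub_int_mul_pi, Real.sin_sub_int_mul_pi, mul_mul_mul_comm, ← mul_zpow] at h3
  simpa using h3

lemma hasDerivAt_comp_mul {f : ℝ → ℝ} {f' a r : ℝ} (hf : HasDerivAt f f' (a * r)) :
    HasDerivAt (fun r => f (a * r)) (a * f') r := by
  refine (hf.comp r ((hasDerivAt_id r).const_mul a)).congr_deriv ?_
  ring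

/-- The Wronskian (times `r`) of `r ↦ J_k(α r)` and `r ↦ J_k(β r)`. -/
def besselWronskian (k : ℕ) (α β r : ℝ) : ℝ :=
  besselK k (α * r) * besselJ k (β * r) - besselJ k (α * r) * besselK k (β * r)

lemma hasDerivAt_besselWronskian (k : ℕ) {α β r : ℝ} (hα : 0 < α) (hβ : 0 < β) (hr : 0 < r) :
    HasDerivAt (besselWronskian k α β)
      ((β ^ 2 - α ^ 2) * r * (besselJ k (α * r) * besselJ k (β * r))) r := by
  refine (((hasDerivAt_comp_mul (hasDerivAt_besselK k (mul_pos hα hr).ne')).mul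
    (hasDerivAt_comp_mul (hasDerivAt_besselJ k (β * r)))).sub
    ((hasDerivAt_comp_mul (hasDerivAt_besselJ k (α * r))).mul
    (hasDerivAt_comp_mul (hasDerivAt_besselK k (mul_pos hβ hr).ne')))).congr_deriv ?_
  simp only [besselK]
  field_simp
  ring

lemma IsPhase.besselWronskian_eq {k : ℕ} {φ ρ : ℝ → ℝ} (h : IsPhase k φ ρ) {α β r : ℝ}
    (hα : 0 < α) (hβ : 0 < β) (hr : 0 < r) :
    besselWronskian k α β r =
      -(ρ (α * r) * ρ (β * r) * Real.sin (φ (α * r) - φ (β * r))) := by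
  rw [besselWronskian, h.besselJ_eq _ (mul_pos hα hr), h.besselJ_eq _ (mul_pos hβ hr),
    h.besselK_eq _ (mul_pos hα hr), h.besselK_eq _ (mul_pos hβ hr), Real.sin_sub]
  ring

lemma IsPhase.hasDerivAt_sub {k : ℕ} {φ ρ : ℝ → ℝ} (h : IsPhase k φ ρ) {α β r : ℝ}
    (hα : 0 < α) (hβ : 0 < β) (hr : 0 < r) :
    HasDerivAt (fun r => φ (α * r) - φ (β * r))
      (α * (((((α * r) ^ 2 - k ^ 2) * Real.sin (φ (α * r)) ^ 2 + Real.cos (φ (α * r)) ^ 2))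
        / (α * r)) - β * (((((β * r) ^ 2 - k ^ 2) * Real.sin (φ (β * r)) ^ 2
        + Real.cos (φ (β * r)) ^ 2)) / (β * r))) r :=
  (hasDerivAt_comp_mul (h.hasDerivAt _ (mul_pos hα hr))).sub
    (hasDerivAt_comp_mul (h.hasDerivAt _ (mul_pos hβ hr)))

/-- The phase difference can cross the level `π` only upwards: where it equals `π`, the two Bessel
functions have opposite signs immediately to the right, so that the Wronskian increases there. -/
lemma IsPhase.exists_pi_le_sub {k : ℕ} {φ ρ : ℝ → ℝ} (h : IsPhase k φ ρ) {α β r y : ℝ}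
    (hβ : 0 < β) (hβα : β < α) (hr : 0 < r) (hD : φ (α * r) - φ (β * r) = Real.pi)
    (hry : r < y) : ∃ s ∈ Ioc r y, Real.pi ≤ φ (α * s) - φ (β * s) := by
  have hα := hβ.trans hβα
  have hpi := Real.pi_pos
  set m : ℤ := ⌊φ (β * r) / Real.pi⌋ with hm
  have hm1 : m * Real.pi ≤ φ (β * r) := (le_div_iff₀ hpi).1 (Int.floor_le _)
  have hm2 : φ (β * r) < (m + 1) * Real.pi := (div_lt_iff₀ hpi).1 (Int.lt_floor_add_one _)
  by_contra! hcon
  have hcont : ContinuousAt (fun s => φ (β * s)) r :=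
    (hasDerivAt_comp_mul (h.hasDerivAt _ (mul_pos hβ hr))).continuousAt
  obtain ⟨z, hz, hzlt⟩ : ∃ z ∈ Ioc r y, φ (β * z) < (m + 1) * Real.pi := by
    have h1 := eventually_nhdsWithin_of_eventually_nhds (s := Ioi r)
      (hcont.eventually (gt_mem_nhds hm2))
    obtain ⟨z, hz1, hz2⟩ := (h1.and (Ioc_mem_nhdsGT hry)).exists
    exact ⟨z, hz2, hz1⟩
  obtain ⟨s, hs, hds⟩ := exists_deriv_eq_slope (besselWronskian k α β) hz.1
    (fun t ht => (hasDerivAt_besselWronskian k hα hβ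
      (hr.trans_le ht.1)).continuousAt.continuousWithinAt)
    (fun t ht => (hasDerivAt_besselWronskian k hα hβ
      (hr.trans ht.1)).differentiableAt.differentiableWithinAt)
  have hs0 : 0 < s := hr.trans hs.1
  have hz0 : 0 < z := hr.trans hz.1
  have hWr : besselWronskian k α β r = 0 := by
    rw [h.besselWronskian_eq hα hβ hr, hD, Real.sin_pi, mul_zero, neg_zero]
  have hWz : besselWronskian k α β z < 0 := by
    rw [h.besselWronskian_eq hα hβ hz0]
    have := Real.sin_pos_of_pos_of_lt_pi (x := φ (α * z) - φ (β * z))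
      (sub_pos.2 (h.strictMonoOn (mul_pos hβ hz0) (mul_pos hα hz0)
        (mul_lt_mul_of_pos_right hβα hz0))) (hcon z hz)
    have h1 := h.modulus_pos _ (mul_pos hα hz0)
    have h2 := h.modulus_pos _ (mul_pos hβ hz0)
    rw [neg_lt_zero]
    positivity
  rw [(hasDerivAt_besselWronskian k hα hβ hs0).deriv, hWr, sub_zero] at hds
  have hneg : besselWronskian k α β z / (z - r) < 0 := div_neg_of_neg_of_pos hWz (sub_pos.2 hz.1)
  have hb1 : φ (β * r) < φ (β * s) :=
    h.strictMonoOn (mul_pos hβ hr) (mul_pos hβ hs0) (mul_lt_mul_of_pos_left hs.1 hβ)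
  have hb2 : φ (β * s) < φ (β * z) :=
    h.strictMonoOn (mul_pos hβ hs0) (mul_pos hβ hz0) (mul_lt_mul_of_pos_left hs.2 hβ)
  have ha1 : φ (α * r) < φ (α * s) :=
    h.strictMonoOn (mul_pos hα hr) (mul_pos hα hs0) (mul_lt_mul_of_pos_left hs.1 hα)
  have ha2 := hcon s ⟨hs.1, hs.2.le.trans hz.2⟩
  have hsin := sin_mul_sin_pos (x := φ (α * s) - Real.pi) (y := φ (β * s)) m
    ⟨by linarith, by linarith⟩ ⟨by linarith, by linarith⟩
  rw [Real.sin_sub_pi] at hsin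
  have hJJ : besselJ k (α * s) * besselJ k (β * s) < 0 := by
    rw [h.besselJ_eq _ (mul_pos hα hs0), h.besselJ_eq _ (mul_pos hβ hs0)]
    have := mul_pos (mul_pos (h.modulus_pos _ (mul_pos hα hs0))
      (h.modulus_pos _ (mul_pos hβ hs0))) hsin
    linarith
  have : 0 < (β ^ 2 - α ^ 2) * s * (besselJ k (α * s) * besselJ k (β * s)) := by
    refine mul_pos_of_neg_of_neg (mul_neg_of_neg_of_pos ?_ hs0) hJJ
    nlinarith
  linarith

/-- If the phase difference equals `π` at `r = 1` and `J_k(β) ≠ 0`, then it is below `π` on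
`(0, 1)`. Otherwise it would be at least `π` on both sides of `1`, in spite of its positive
derivative there. -/
lemma IsPhase.sub_lt_pi {k : ℕ} {φ ρ : ℝ → ℝ} (h : IsPhase k φ ρ) {α β r : ℝ}
    (hβ : 0 < β) (hβα : β < α) (hD : φ α - φ β = Real.pi) (hJβ : besselJ k β ≠ 0)
    (hr : r ∈ Ioo (0 : ℝ) 1) : φ (α * r) - φ (β * r) < Real.pi := by
  have hα := hβ.trans hβα
  by_contra! hcon
  have hc : ∀ s, 0 < s → ContinuousAt (fun s => φ (α * s) - φ (β * s)) s := fun s hs =>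
    (h.hasDerivAt_sub hα hβ hs).continuousAt
  have hsub : Icc r 2 ⊆ {s | Real.pi ≤ φ (α * s) - φ (β * s)} := by
    refine IsClosed.Icc_subset_of_forall_exists_gt ?_ hcon ?_
    · rw [inter_comm]
      refine ContinuousOn.preimage_isClosed_of_isClosed (t := Ici Real.pi) (fun s hs =>
        (hc s (hr.1.trans_le hs.1)).continuousWithinAt) isClosed_Icc isClosed_Ici
    · rintro s ⟨hs, hs'⟩ y hy
      have hs0 : 0 < s := hr.1.trans_le hs'.1
      rcases (show Real.pi ≤ φ (α * s) - φ (β * s) from hs).eq_or_lt with heq | hlt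
      · obtain ⟨t, ht, ht'⟩ := h.exists_pi_le_sub hβ hβα hs0 heq.symm hy
        exact ⟨t, ht', ht⟩
      · have h1 := eventually_nhdsWithin_of_eventually_nhds (s := Ioi s)
          ((hc s hs0).eventually (lt_mem_nhds hlt))
        obtain ⟨t, ht, ht'⟩ := (h1.and (Ioc_mem_nhdsGT hy)).exists
        exact ⟨t, le_of_lt ht, ht'⟩
  have hmin : IsLocalMin (fun s => φ (α * s) - φ (β * s)) 1 := by
    filter_upwards [Icc_mem_nhds hr.2 one_lt_two] with s hs
    simp only [mul_one, hD]
    exact hsub hs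
  have h0 := hmin.hasDerivAt_eq_zero (h.hasDerivAt_sub hα hβ one_pos)
  have hφ : φ α = φ β + Real.pi := by linarith
  simp only [mul_one, hφ, Real.sin_add_pi, Real.cos_add_pi, neg_sq] at h0
  rw [mul_div_cancel₀ _ hα.ne', mul_div_cancel₀ _ hβ.ne'] at h0
  have h1 : (α ^ 2 - β ^ 2) * Real.sin (φ β) ^ 2 = 0 := by linarith
  rw [h.besselJ_eq β hβ] at hJβ
  have h2 := right_ne_zero_of_mul hJβ
  have h3 : α ^ 2 - β ^ 2 ≠ 0 := by nlinarith
  simp [h2, h3] at h1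

/-! ### Zeros of the profile -/

lemma IsPhase.besselWronskian_ne_zero {k : ℕ} {φ ρ : ℝ → ℝ} (h : IsPhase k φ ρ) {α β r : ℝ}
    (hβ : 0 < β) (hβα : β < α) (hr : 0 < r) (hD : φ (α * r) - φ (β * r) < Real.pi) :
    besselWronskian k α β r ≠ 0 := by
  have hα := hβ.trans hβα
  rw [h.besselWronskian_eq hα hβ hr]
  have h1 := Real.sin_pos_of_pos_of_lt_pi (x := φ (α * r) - φ (β * r))
    (sub_pos.2 (h.strictMonoOn (mul_pos hβ hr) (mul_pos hα hr)
      (mul_lt_mul_of_pos_right hβα hr))) hD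
  have h2 := h.modulus_pos _ (mul_pos hα hr)
  have h3 := h.modulus_pos _ (mul_pos hβ hr)
  rw [neg_ne_zero]
  positivity

lemma hasDerivAt_profile (k : ℕ) (α β c d r : ℝ) :
    HasDerivAt (fun r => c * besselJ k (α * r) + d * besselJ k (β * r))
      (c * (α * besselJ' k (α * r)) + d * (β * besselJ' k (β * r))) r :=
  ((hasDerivAt_comp_mul (hasDerivAt_besselJ k (α * r))).const_mul c).add
    ((hasDerivAt_comp_mul (hasDerivAt_besselJ k (β * r))).const_mul d)

/-- A double zero of `c J_k(α r) + d J_k(β r)` is a zero of the Wronskian. -/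
lemma deriv_profile_ne_zero {k : ℕ} {α β c d r : ℝ} (hc : c ≠ 0)
    (hW : besselWronskian k α β r ≠ 0)
    (hR : c * besselJ k (α * r) + d * besselJ k (β * r) = 0) :
    deriv (fun r => c * besselJ k (α * r) + d * besselJ k (β * r)) r ≠ 0 := by
  rw [(hasDerivAt_profile k α β c d r).deriv]
  intro h0
  refine hW ((mul_eq_zero_iff_left hc).1 ?_)
  simp only [besselWronskian, besselK]
  linear_combination r * besselJ k (β * r) * h0 - β * r * besselJ' k (β * r) * hR

/-- Between two zeros of `c J_k(α r) + d J_k(β r)` in `(0, 1]` there is a zero of `J_k(β r)`: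
otherwise the quotient `J_k(α r) / J_k(β r)`, whose derivative is a multiple of the Wronskian,
would be strictly monotone and take the value `-d / c` twice. -/
lemma exists_besselJ_eq_zero_between {k : ℕ} {α β c d r s : ℝ} (hc : c ≠ 0)
    (hrs : r < s) (hW : ∀ t ∈ Ioo r s, besselWronskian k α β t ≠ 0)
    (hRr : c * besselJ k (α * r) + d * besselJ k (β * r) = 0)
    (hRs : c * besselJ k (α * s) + d * besselJ k (β * s) = 0) :
    ∃ t ∈ Icc r s, besselJ k (β * t) = 0 := by
  by_contra! hg
  have hd : ∀ t ∈ Icc r s, HasDerivAt (fun t => besselJ k (α * t) / besselJ k (β * t))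
      ((α * besselJ' k (α * t) * besselJ k (β * t) - besselJ k (α * t) * (β * besselJ' k (β * t)))
        / besselJ k (β * t) ^ 2) t := fun t ht =>
    (hasDerivAt_comp_mul (hasDerivAt_besselJ k (α * t))).div
      (hasDerivAt_comp_mul (hasDerivAt_besselJ k (β * t))) (hg t ht)
  have hq : ∀ t ∈ Icc r s, c * besselJ k (α * t) + d * besselJ k (β * t) = 0 →
      besselJ k (α * t) / besselJ k (β * t) = -d / c := fun t ht hR => by
    rw [div_eq_div_iff (hg t ht) hc]
    linear_combination hR
  obtain ⟨t, ht, ht0⟩ := exists_hasDerivAt_eq_zero hrs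
    (fun t ht => (hd t ht).continuousAt.continuousWithinAt)
    ((hq r ⟨le_rfl, hrs.le⟩ hRr).trans (hq s ⟨hrs.le, le_rfl⟩ hRs).symm)
    (fun t ht => hd t (Ioo_subset_Icc_self ht))
  refine hW t ht ?_
  rw [div_eq_zero_iff, or_iff_left (pow_ne_zero 2 (hg t (Ioo_subset_Icc_self ht)))] at ht0
  simp only [besselWronskian, besselK]
  linear_combination t * ht0

lemma sin_ne_zero_of_mem_Ioo {x : ℝ} (m : ℤ)
    (hx : x ∈ Ioo (m * Real.pi) ((m + 1) * Real.pi)) : Real.sin x ≠ 0 := fun h0 => by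
  have := sin_mul_sin_pos m hx hx
  simp [h0] at this

/-- Where `J_k(α r)` and `J_k(β r)` do not have opposite signs, a combination with coefficients
`c`, `d` of the same sign has the sign of `c J_k(α r)`. -/
lemma IsPhase.profile_mul_pos {k : ℕ} {φ ρ : ℝ → ℝ} (h : IsPhase k φ ρ) {α β c d r : ℝ}
    (hα : 0 < α) (hβ : 0 < β) (hcd : 0 < c * d) (hr : 0 < r) (hs : Real.sin (φ (α * r)) ≠ 0)
    (hss : 0 ≤ Real.sin (φ (α * r)) * Real.sin (φ (β * r))) :
    0 < (c * besselJ k (α * r) + d * besselJ k (β * r)) * (c * Real.sin (φ (α * r))) := by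
  have h1 := h.modulus_pos _ (mul_pos hα hr)
  have h2 := h.modulus_pos _ (mul_pos hβ hr)
  have hc : c ≠ 0 := left_ne_zero_of_mul hcd.ne'
  rw [h.besselJ_eq _ (mul_pos hα hr), h.besselJ_eq _ (mul_pos hβ hr)]
  have h3 : 0 < ρ (α * r) * (c * Real.sin (φ (α * r))) ^ 2 := by positivity
  have h4 := mul_nonneg (mul_pos h2 hcd).le hss
  linarith

/-- The profile changes sign on each interval on which `φ(β r)` runs from `i π` to `(i + 1) π`: at
its endpoints `J_k(β r)` vanishes and `φ(α r)` exceeds `φ(β r)` by less than `π`, so the profile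
has the signs of `(-1)^i c` and `(-1)^(i+1) c` there. For `i = 0` both Bessel functions are
positive near the left endpoint `0`. -/
lemma IsPhase.exists_profile_zero {k : ℕ} {φ ρ : ℝ → ℝ} (h : IsPhase k φ ρ) {α β c d : ℝ}
    {m i : ℕ} (hβ : 0 < β) (hβα : β < α) (hcd : 0 < c * d) (hm : m * Real.pi < φ β)
    (hsub : ∀ r ∈ Ioo (0 : ℝ) 1, φ (α * r) - φ (β * r) < Real.pi) (hi : i < m) :
    ∃ r ∈ Ioo (0 : ℝ) 1, c * besselJ k (α * r) + d * besselJ k (β * r) = 0 ∧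
      φ (β * r) ∈ Ioo (i * Real.pi) ((i + 1) * Real.pi) := by
  have hα := hβ.trans hβα
  have hpi := Real.pi_pos
  have him : (i + 1) * Real.pi < φ β := by
    have : (i : ℝ) + 1 ≤ m := by exact_mod_cast hi
    nlinarith
  have hlt : ∀ r, 0 < r → φ (β * r) < φ (α * r) := fun r hr =>
    h.strictMonoOn (mul_pos hβ hr) (mul_pos hα hr) (mul_lt_mul_of_pos_right hβα hr)
  have hcmp : ∀ r s, 0 < r → 0 < s → (φ (β * r) < φ (β * s) ↔ r < s) := fun r s hr hs => by
    rw [h.strictMonoOn.lt_iff_lt (mul_pos hβ hr) (mul_pos hβ hs), mul_lt_mul_iff_right₀ hβ]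
  have hzero : ∀ j : ℕ, ∃ r, 0 < r ∧ φ (β * r) = (j + 1) * Real.pi := fun j => by
    obtain ⟨h0, hj⟩ := h.besselZero_succ_spec j
    exact ⟨besselZero k (j + 1) / β, div_pos h0 hβ, by rw [mul_div_cancel₀ _ hβ.ne', hj]⟩
  obtain ⟨e, he0, he⟩ := hzero i
  have he1 : e < 1 := by rw [← hcmp e 1 he0 one_pos, mul_one, he]; exact him
  -- A point at or to the right of the previous zero of `J_k(β r)`, with `J_k(α r)` still of the
  -- sign `(-1)^i`.
  obtain ⟨l, hl0, hl1, hl2, hl3⟩ : ∃ l, 0 < l ∧ φ (β * l) ∈ Ico (i * Real.pi) ((i + 1) * Real.pi) ∧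
      φ (α * l) ∈ Ioo (i * Real.pi) ((i + 1) * Real.pi) ∧
      0 ≤ Real.sin (φ (α * l)) * Real.sin (φ (β * l)) := by
    rcases i with _ | j
    · obtain ⟨x, hx0, hx⟩ := h.exists_phase_lt_pi
      have hl0 : 0 < x / α := div_pos hx0 hα
      have h1 := hlt _ hl0
      have h2 := h.phase_pos _ (mul_pos hβ hl0)
      have h3 := h.phase_pos _ hx0
      rw [mul_div_cancel₀ _ hα.ne'] at h1
      refine ⟨x / α, hl0, ?_⟩
      rw [mul_div_cancel₀ _ hα.ne']
      simp only [Nat.cast_zero, zero_mul, zero_add, one_mul]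
      refine ⟨⟨h2.le, h1.trans hx⟩, ⟨h3, hx⟩, mul_nonneg ?_ ?_⟩
      · exact (Real.sin_pos_of_pos_of_lt_pi h3 hx).le
      · exact (Real.sin_pos_of_pos_of_lt_pi h2 (h1.trans hx)).le
    · obtain ⟨l, hl0, hl⟩ := hzero j
      have h1 := hlt l hl0
      have hl1 : l < 1 := by
        rw [← hcmp l 1 hl0 one_pos, mul_one, hl]
        push_cast at him
        linarith
      have h2 := hsub l ⟨hl0, hl1⟩
      have h3 : Real.sin (φ (β * l)) = 0 := by
        rw [hl, Real.sin_eq_zero_iff]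
        exact ⟨j + 1, by push_cast; ring⟩
      refine ⟨l, hl0, ⟨?_, ?_⟩, ⟨?_, ?_⟩, by rw [h3, mul_zero]⟩ <;> push_cast <;> linarith
  have hle : l < e := by rw [← hcmp l e hl0 he0, he]; exact hl1.2
  have hea1 := hlt e he0
  have hea2 := hsub e ⟨he0, he1⟩
  have hsl : Real.sin (φ (α * l)) ≠ 0 := sin_ne_zero_of_mem_Ioo i (by exact_mod_cast hl2)
  have hse : Real.sin (φ (α * e)) ≠ 0 := sin_ne_zero_of_mem_Ioo (i + 1)
    ⟨by push_cast; linarith, by push_cast; linarith⟩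
  have hsbe : Real.sin (φ (β * e)) = 0 := by
    rw [he, Real.sin_eq_zero_iff]
    exact ⟨i + 1, by push_cast; ring⟩
  have hRl := h.profile_mul_pos (c := c) (d := d) hα hβ hcd hl0 hsl hl3
  have hRe := h.profile_mul_pos (c := c) (d := d) hα hβ hcd he0 hse (by rw [hsbe, mul_zero])
  have hopp : Real.sin (φ (α * l)) * Real.sin (φ (α * e)) < 0 := by
    have := sin_mul_sin_pos (x := φ (α * l)) (y := φ (α * e) - Real.pi) i
      (by exact_mod_cast hl2) ⟨by push_cast; linarith, by push_cast; linarith⟩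
    rw [Real.sin_sub_pi] at this
    linarith
  have hcont : ContinuousOn (fun r => c * besselJ k (α * r) + d * besselJ k (β * r)) (Icc l e) :=
    fun r _ => (hasDerivAt_profile k α β c d r).continuousAt.continuousWithinAt
  have hmul : (c * besselJ k (α * l) + d * besselJ k (β * l)) *
      (c * besselJ k (α * e) + d * besselJ k (β * e)) < 0 := by
    have h1 := mul_pos hRl hRe
    have h2 : c ^ 2 * (Real.sin (φ (α * l)) * Real.sin (φ (α * e))) < 0 :=
      mul_neg_of_pos_of_neg (by have := left_ne_zero_of_mul hcd.ne'; positivity) hopp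
    by_contra! h3
    have := mul_nonpos_of_nonneg_of_nonpos h3 h2.le
    linarith
  obtain ⟨r, hr, hR⟩ : ∃ r ∈ Ioo l e, c * besselJ k (α * r) + d * besselJ k (β * r) = 0 := by
    rcases mul_neg_iff.1 hmul with ⟨h1, h2⟩ | ⟨h1, h2⟩
    · exact intermediate_value_Ioo' hle.le hcont ⟨h2, h1⟩
    · exact intermediate_value_Ioo hle.le hcont ⟨h1, h2⟩
  have hr0 : 0 < r := hl0.trans hr.1
  refine ⟨r, ⟨hr0, hr.2.trans he1⟩, hR, hl1.1.trans_lt ((hcmp l r hl0 hr0).2 hr.1), ?_⟩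
  rw [← he]
  exact (hcmp r e hr0 he0).2 hr.2

lemma IsPhase.profile_zero_unique {k : ℕ} {φ ρ : ℝ → ℝ} (h : IsPhase k φ ρ) {α β c d r s : ℝ}
    (hβ : 0 < β) (hβα : β < α) (hc : c ≠ 0)
    (hsub : ∀ r ∈ Ioo (0 : ℝ) 1, φ (α * r) - φ (β * r) < Real.pi) (hr : 0 < r) (hrs : r < s)
    (hs : s ≤ 1) (m : ℤ) (hmr : m * Real.pi < φ (β * r)) (hms : φ (β * s) < (m + 1) * Real.pi)
    (hRr : c * besselJ k (α * r) + d * besselJ k (β * r) = 0) :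
    c * besselJ k (α * s) + d * besselJ k (β * s) ≠ 0 := by
  intro hRs
  obtain ⟨t, ht, ht0⟩ := exists_besselJ_eq_zero_between hc hrs (fun t ht =>
    h.besselWronskian_ne_zero hβ hβα (hr.trans ht.1)
      (hsub t ⟨hr.trans ht.1, ht.2.trans_le hs⟩)) hRr hRs
  have ht' : 0 < t := hr.trans_le ht.1
  rw [h.besselJ_eq _ (mul_pos hβ ht')] at ht0
  have hmono := h.strictMonoOn.monotoneOn
  refine mul_ne_zero (h.modulus_pos _ (mul_pos hβ ht')).ne' (sin_ne_zero_of_mem_Ioo m ⟨?_, ?_⟩) ht0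
  · exact hmr.trans_le (hmono (mul_pos hβ hr) (mul_pos hβ ht')
      (mul_le_mul_of_nonneg_left ht.1 hβ.le))
  · exact (hmono (mul_pos hβ ht') (mul_pos hβ (hr.trans hrs))
      (mul_le_mul_of_nonneg_left ht.2 hβ.le)).trans_lt hms

lemma IsPhase.ncard_profile_zeros {k : ℕ} {φ ρ : ℝ → ℝ} (h : IsPhase k φ ρ) {α β c d : ℝ}
    {m : ℕ} (hβ : 0 < β) (hβα : β < α) (hcd : 0 < c * d)
    (hm : φ β ∈ Ioo (m * Real.pi) ((m + 1) * Real.pi))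
    (hsub : ∀ r ∈ Ioo (0 : ℝ) 1, φ (α * r) - φ (β * r) < Real.pi)
    (hR1 : c * besselJ k α + d * besselJ k β = 0) :
    {r : ℝ | r ∈ Ioo (0 : ℝ) 1 ∧ c * besselJ k (α * r) + d * besselJ k (β * r) = 0}.ncard = m := by
  have hα := hβ.trans hβα
  have hpi := Real.pi_pos
  have hc : c ≠ 0 := left_ne_zero_of_mul hcd.ne'
  choose! z hz1 hz2 hz3 using fun (i : ℕ) (hi : i < m) =>
    h.exists_profile_zero hβ hβα hcd hm.1 hsub hi
  have himage : {r : ℝ | r ∈ Ioo (0 : ℝ) 1 ∧ c * besselJ k (α * r) + d * besselJ k (β * r) = 0}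
      = z '' (Finset.range m : Set ℕ) := by
    ext r
    simp only [mem_ofPred_eq, mem_image, Finset.coe_range, mem_Iio]
    constructor
    · rintro ⟨hr, hR⟩
      have hW := h.besselWronskian_ne_zero hβ hβα hr.1 (hsub r hr)
      have hJ : besselJ k (β * r) ≠ 0 := fun h0 => hW <| by
        have h1 : besselJ k (α * r) = 0 := by simpa [h0, hc] using hR
        rw [besselWronskian, h0, h1, mul_zero, zero_mul, sub_zero]
      have hbr : 0 < β * r := mul_pos hβ hr.1
      set i : ℤ := ⌊φ (β * r) / Real.pi⌋
      have hi1 : i * Real.pi ≤ φ (β * r) := (le_div_iff₀ hpi).1 (Int.floor_le _)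
      have hi2 : φ (β * r) < (i + 1) * Real.pi := (div_lt_iff₀ hpi).1 (Int.lt_floor_add_one _)
      have hi1' : i * Real.pi < φ (β * r) := lt_of_le_of_ne hi1 fun h0 =>
        hJ ((h.besselJ_eq_zero_iff hbr).2 ⟨i, h0⟩)
      have hi0 : 0 ≤ i := Int.floor_nonneg.2 (div_pos (h.phase_pos _ hbr) hpi).le
      clear_value i
      lift i to ℕ using hi0
      simp only [Int.cast_natCast] at hi1' hi2
      have him : i < m := by
        by_contra! hmi
        have h1 : (m : ℝ) ≤ i := by exact_mod_cast hmi
        refine h.profile_zero_unique (s := 1) hβ hβα hc hsub hr.1 hr.2 le_rfl (m : ℤ) ?_ ?_ hR ?_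
        · refine lt_of_le_of_lt ?_ hi1'
          exact_mod_cast mul_le_mul_of_nonneg_right h1 hpi.le
        · rw [mul_one]; exact_mod_cast hm.2
        · rw [mul_one, mul_one]; exact hR1
      refine ⟨i, him, ?_⟩
      have h3 := hz3 i him
      rcases lt_trichotomy (z i) r with hlt | heq | hgt
      · exact (h.profile_zero_unique hβ hβα hc hsub (hz1 i him).1 hlt hr.2.le (i : ℤ)
          (by exact_mod_cast h3.1) (by exact_mod_cast hi2) (hz2 i him) hR).elim
      · exact heq
      · exact (h.profile_zero_unique hβ hβα hc hsub hr.1 hgt (hz1 i him).2.le (i : ℤ)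
          (by exact_mod_cast hi1') (by exact_mod_cast h3.2) hR (hz2 i him)).elim
    · rintro ⟨i, hi, rfl⟩
      exact ⟨hz1 i hi, hz2 i hi⟩
  rw [himage, InjOn.ncard_image, ncard_coe_finset, Finset.card_range]
  intro i hi j hj hij
  have hi' := hz3 i (by simpa using hi)
  have hj' := hz3 j (by simpa using hj)
  rw [hij] at hi'
  have h1 : (i : ℝ) < j + 1 := lt_of_mul_lt_mul_right (hi'.1.trans hj'.2) hpi.le
  have h2 : (j : ℝ) < i + 1 := lt_of_mul_lt_mul_right (hj'.1.trans hi'.2) hpi.le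
  have h3 : i < j + 1 := by exact_mod_cast h1
  have h4 : j < i + 1 := by exact_mod_cast h2
  omega

/-! ### The first radial profile -/

lemma exists_isRadialProfile_one {k : ℕ} {κ : ℝ} (hJ : besselJ k (alphaRoot k κ 1) ≠ 0)
    (hF : F k κ (alphaRoot k κ 1) = 0) : ∃ R : ℝ → ℝ, IsRadialProfile k κ 1 R := by
  refine ⟨_, besselJ k (κ / alphaRoot k κ 1), -besselJ k (alphaRoot k κ 1), ?_, by ring, ?_,
    fun r => rfl⟩
  · simp [hJ]
  · rw [F] at hF
    linear_combination -hF

lemma IsPhase.radialProfile_spec {k : ℕ} {φ ρ : ℝ → ℝ} (h : IsPhase k φ ρ) {κ : ℝ} (hκ : 0 < κ)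
    {m : ℕ} (hmem : alphaRoot k κ 1 ∈ Ioo (besselZero k (m + 1)) (besselZero k (m + 2))) :
    (∃ R : ℝ → ℝ, IsRadialProfile k κ 1 R) ∧
      ∀ R : ℝ → ℝ, IsRadialProfile k κ 1 R →
        {r : ℝ | r ∈ Ioo 0 1 ∧ R r = 0}.ncard = m ∧
          ∀ r ∈ Ioo (0 : ℝ) 1, R r = 0 → deriv R r ≠ 0 := by
  obtain ⟨hsα, hαβ⟩ := h.alphaRoot_one_spec hκ
  set α := alphaRoot k κ 1 with hα_def
  set β := κ / α with hβ_def
  have hα : 0 < α := (Real.sqrt_nonneg κ).trans_lt hsα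
  have hβ : 0 < β := div_pos hκ hα
  have hβα : β < α := by
    rw [← h.strictMonoOn.lt_iff_lt hβ hα]
    linarith [Real.pi_pos]
  obtain ⟨hp0, hp⟩ := h.besselZero_succ_spec m
  obtain ⟨hq0, hq⟩ := h.besselZero_succ_spec (m + 1)
  have h1 := h.strictMonoOn hp0 hα hmem.1
  have h2 := h.strictMonoOn hα hq0 hmem.2
  rw [hp] at h1
  rw [show m + 2 = m + 1 + 1 from rfl, hq] at h2
  push_cast at h2
  have hm : φ β ∈ Ioo (m * Real.pi) ((m + 1) * Real.pi) := ⟨by linarith, by linarith⟩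
  have hφα : φ α = φ β + Real.pi := by linarith
  have hsin : Real.sin (φ β) ≠ 0 := sin_ne_zero_of_mem_Ioo m (by exact_mod_cast hm)
  have hJα : besselJ k α = -(ρ α * Real.sin (φ β)) := by
    rw [h.besselJ_eq α hα, hφα, Real.sin_add_pi, mul_neg]
  have hJβ := h.besselJ_eq β hβ
  have hρα := h.modulus_pos α hα
  have hρβ := h.modulus_pos β hβ
  have hJβ0 : besselJ k β ≠ 0 := by rw [hJβ]; exact mul_ne_zero hρβ.ne' hsin
  have hsub : ∀ r ∈ Ioo (0 : ℝ) 1, φ (α * r) - φ (β * r) < Real.pi := fun r hr =>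
    h.sub_lt_pi hβ hβα hαβ hJβ0 hr
  refine ⟨exists_isRadialProfile_one ?_ ?_, ?_⟩
  · rw [← hα_def, hJα]
    exact neg_ne_zero.2 (mul_ne_zero hρα.ne' hsin)
  · exact (h.F_eq_zero_iff hκ hα).2 ⟨1, by rw [hαβ]; push_cast; ring⟩
  · rintro R ⟨c, d, hne, hR1, -, hR⟩
    have hRfun : R = fun r => c * besselJ k (α * r) + d * besselJ k (β * r) := funext hR
    -- The boundary condition and the opposite signs of `J_k(α)`, `J_k(β)` give `c`, `d` the same
    -- sign.
    have hlin : c * ρ α = d * ρ β := by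
      have h3 : (c * ρ α - d * ρ β) * Real.sin (φ β) = 0 := by
        rw [← hα_def, ← hβ_def, hJα, hJβ] at hR1
        linear_combination -hR1
      linarith [(mul_eq_zero_iff_right hsin).1 h3]
    have hd : d ≠ 0 := by
      rintro rfl
      rw [zero_mul, mul_eq_zero_iff_right hρα.ne'] at hlin
      exact hne (by rw [hlin])
    have hcd : 0 < c * d := by
      have h3 : 0 < ρ α * (c * d) := by
        rw [show ρ α * (c * d) = c * ρ α * d by ring, hlin,
          show d * ρ β * d = d ^ 2 * ρ β by ring]
        positivity
      exact pos_of_mul_pos_right h3 hρα.le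
    rw [hRfun]
    refine ⟨h.ncard_profile_zeros hβ hβα hcd hm hsub hR1, fun r hr hRr => ?_⟩
    exact deriv_profile_ne_zero (left_ne_zero_of_mul hcd.ne')
      (h.besselWronskian_ne_zero hβ hβα hr.1 (hsub r hr)) hRr

end Buckling

end

theorem mainTheorem10 (k n : ℕ) (hn : 2 ≤ n) (κ : ℝ) (hκ : 0 < κ) :
    (κ ∈ Set.Ioo (Buckling.besselZero k (n - 1) * Buckling.besselZero k n)
          (Buckling.besselZero k n * Buckling.besselZero k (n + 1)) ↔
        Buckling.alphaRoot k κ 1 ∈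
          Set.Ioo (Buckling.besselZero k n) (Buckling.besselZero k (n + 1))) ∧
      (κ ∈ Set.Ioo (Buckling.besselZero k (n - 1) * Buckling.besselZero k n)
          (Buckling.besselZero k n * Buckling.besselZero k (n + 1)) →
        (∃ R : ℝ → ℝ, Buckling.IsRadialProfile k κ 1 R) ∧
          ∀ R : ℝ → ℝ, Buckling.IsRadialProfile k κ 1 R →
            {r : ℝ | r ∈ Set.Ioo 0 1 ∧ R r = 0}.ncard = n - 1 ∧
              ∀ r ∈ Set.Ioo (0 : ℝ) 1, R r = 0 → deriv R r ≠ 0) := by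
  obtain ⟨φ, ρ, h⟩ := Buckling.exists_isPhase k
  obtain ⟨m, rfl⟩ : ∃ m, n = m + 1 := ⟨n - 1, by omega⟩
  have hiff := h.mem_Ioo_iff_alphaRoot_mem hκ m
  exact ⟨hiff, fun hmem => h.radialProfile_spec hκ (hiff.1 hmem)⟩
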